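/- Let $d\ge 2$, let $S^{d-1}=\{x\in\mathbb R^d:|x|=1\}$, and let $f:[0,4]\to(-\infty,\infty]$ be finite, non-increasing and convex on $(0,4]$, differentiable on $(0,4)$ with a concave derivative $f'$ on $(0,4)$, and such that $\lim_{t\to0^+}f(t)=f(0)$ (possibly $+\infty$). For a set $\omega\subset S^{d-1}$ of exactly $d+1$ points put $$P_f(\omega,S^{d-1})=\min_{x\in S^{d-1}}\sum_{v\in\omega}f(|x-v|^2),\qquad \mathcal P_f(S^{d-1})=\sup\{P_f(\omega,S^{d-1}):\omega\subset S^{d-1},\ \#\omega=d+1\}$$ (the minimum is attained). Let $\omega_d^*$ be the set of vertices of any regular $d$-simplex inscribed in $S^{d-1}$ (such simplices exist). Then $$P_f(\omega,S^{d-1})\le P_f(\omega_d^*,S^{d-1})$$ for every $(d+1)$-point set $\omega\subset S^{d-1}$, and $$\mathcal P_f(S^{d-1})=P_f(\omega_d^*,S^{d-1})=f(4)+d\cdot f\left(2-\frac2d\right).$$ If, in addition, $f$ is strictly convex on $(0,4]$, then equality $P_f(\omega,S^{d-1})=P_f(\omega_d^*,S^{d-1})$ holds if and only if $\omega$ is the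 set of vertices of a regular $d$-simplex inscribed in $S^{d-1}$. -/

import Mathlib

open Set Filter Topology

namespace Polarization

/-- The unit sphere `S^{d-1}` of the Euclidean space `ℝ^d`. -/
abbrev unitSphere (d : ℕ) : Set (EuclideanSpace ℝ (Fin d)) :=
  Metric.sphere (0 : EuclideanSpace ℝ (Fin d)) 1

/-- `ω` is a configuration of `d + 1` (distinct) points on `S^{d-1}`. -/
def IsConfig (d : ℕ) (ω : Finset (EuclideanSpace ℝ (Fin d))) : Prop :=
  (ω : Set (EuclideanSpace ℝ (Fin d))) ⊆ unitSphere d ∧ ω.card = d + 1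

/-- `ω` is the set of vertices of a regular `d`-simplex (a nondegenerate simplex with all edges of
the same length) inscribed in `S^{d-1}`. -/
def IsRegularSimplex (d : ℕ) (ω : Finset (EuclideanSpace ℝ (Fin d))) : Prop :=
  (ω : Set (EuclideanSpace ℝ (Fin d))) ⊆ unitSphere d ∧
    ∃ s : Affine.Simplex ℝ (EuclideanSpace ℝ (Fin d)) d,
      s.Equilateral ∧ Set.range s.points = (ω : Set (EuclideanSpace ℝ (Fin d)))

/-- The potential `p_f(x, ω) = ∑_{v ∈ ω} f(|x - v|²)`. Only the values of `f` on `[0,4]` matter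
when `x` and `ω` lie on the unit sphere. -/
noncomputable def potential {d : ℕ} (f : ℝ → EReal)
    (ω : Finset (EuclideanSpace ℝ (Fin d))) (x : EuclideanSpace ℝ (Fin d)) : EReal :=
  ∑ v ∈ ω, f (‖x - v‖ ^ 2)

/-- `P_f(ω, S^{d-1})`, the infimum over the sphere of the potential of `ω`, taken in the complete
lattice of extended reals. -/
noncomputable def minPotential {d : ℕ} (f : ℝ → EReal)
    (ω : Finset (EuclideanSpace ℝ (Fin d))) : EReal :=
  sInf (potential f ω '' unitSphere d)

/-- `𝒫_f(S^{d-1})`, the supremum of `P_f(ω, S^{d-1})` over all `(d+1)`-point configurations. -/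
noncomputable def maxPolarization (d : ℕ) (f : ℝ → EReal) : EReal :=
  sSup (minPotential f '' {ω : Finset (EuclideanSpace ℝ (Fin d)) | IsConfig d ω})

/-- The conditions on a potential function `f : [0,4] → (-∞,∞]`: finite, non-increasing and convex
on `(0,4]`, differentiable on `(0,4)` with a concave derivative, and continuous at `0` in the
extended sense. The values of `f` outside `[0,4]` are irrelevant. -/
structure IsAdmissible (f : ℝ → EReal) : Prop where
  ne_bot : ∀ t ∈ Icc (0 : ℝ) 4, f t ≠ ⊥
  ne_top : ∀ t ∈ Ioc (0 : ℝ) 4, f t ≠ ⊤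
  antitone : AntitoneOn f (Ioc (0 : ℝ) 4)
  convex : ConvexOn ℝ (Ioc (0 : ℝ) 4) (fun t => (f t).toReal)
  differentiable : ∀ t ∈ Ioo (0 : ℝ) 4, DifferentiableAt ℝ (fun t => (f t).toReal) t
  concave_deriv : ConcaveOn ℝ (Ioo (0 : ℝ) 4) (deriv fun t => (f t).toReal)
  tendsto_zero : Tendsto f (𝓝[>] (0 : ℝ)) (𝓝 (f 0))

end Polarization

namespace Polarization

/-! Put `a = 2 - 2/d`, so the claimed optimum is `f 4 + d * f a`. Upper bound: the `d + 1` points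
satisfy a nontrivial relation `∑ c v • v = 0` with `∑ c v ≥ 0`. Take `v₀` of least weight and a unit
normal `x` to a hyperplane containing the other points. Pairing the relation with `x` shows that,
for a suitable sign of `x` and some `s ∈ [0,1]`, `⟪x, v₀⟫ ≤ -s` and `⟪x, v⟫ ≤ s/d` for all other `v`
(`exists_unit_inner_le`). By monotonicity the potential at `x` is at most `d * f(2 - 2s/d) + f(2 +
2s)`, and convexity pushes these distances out to `a` (`d` times) and `4` without changing their sum
(`convex_comparison`). Lower bound for the simplex: the quadratic touching `f` at `a` and meeting it
at `4` lies below `f`, because `f'` is concave (`exists_quadratic_le`). The simplex is a spherical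
2-design (`IsRegularSimplex.moments`), so the quadratic has a constant potential on the sphere,
equal to `f 4 + d * f a`. Uniqueness: strict convexity forces `s = 1`, hence `x = -v₀` and `⟪v₀, v⟫
= -1/d` for all other `v`. The relation then has equal weights, so every point can play the role of
`v₀`. -/

lemma mem_unitSphere_iff {d : ℕ} {x : EuclideanSpace ℝ (Fin d)} : x ∈ unitSphere d ↔ ‖x‖ = 1 := by
  simp

lemma norm_sub_sq_of_mem_unitSphere {d : ℕ} {x v : EuclideanSpace ℝ (Fin d)}
    (hx : ‖x‖ = 1) (hv : ‖v‖ = 1) : ‖x - v‖ ^ 2 = 2 - 2 * inner ℝ x v := by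
  rw [norm_sub_sq_real, hx, hv]; ring

/-! ### Linear relations and facet normals -/

/-- A unit vector normal to the facet opposite to a point of the configuration. -/
lemma exists_unit_inner_const {d : ℕ} {ω : Finset (EuclideanSpace ℝ (Fin d))}
    (hcard : ω.card = d + 1) (hd : 1 ≤ d) {v₀ : EuclideanSpace ℝ (Fin d)} (h₀ : v₀ ∈ ω) :
    ∃ (x : EuclideanSpace ℝ (Fin d)) (r : ℝ), ‖x‖ = 1 ∧ ∀ v ∈ ω, v ≠ v₀ → inner ℝ x v = r := by
  classical
  have hc : (ω.erase v₀).card = (d - 1) + 1 := by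
    rw [Finset.card_erase_of_mem h₀, hcard]; omega
  have hfr := finrank_vectorSpan_image_finset_le ℝ (id : EuclideanSpace ℝ (Fin d) → _) _ hc
  rw [Finset.image_id] at hfr
  set W := vectorSpan ℝ ((ω.erase v₀ : Finset _) : Set (EuclideanSpace ℝ (Fin d))) with hW
  -- The `d` remaining points span directions of dimension at most `d - 1`.
  have hWtop : W ≠ ⊤ := by
    intro h
    rw [h, finrank_top, finrank_euclideanSpace_fin] at hfr
    omega
  have hperp : Wᗮ ≠ ⊥ := by
    rwa [Ne, Submodule.orthogonal_eq_bot_iff]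
  obtain ⟨y, hy, hy0⟩ := Submodule.exists_mem_ne_zero_of_ne_bot hperp
  have hyn : ‖y‖ ≠ 0 := norm_ne_zero_iff.2 hy0
  obtain ⟨w, hw⟩ : (ω.erase v₀).Nonempty := Finset.card_pos.1 (by omega)
  refine ⟨(‖y‖⁻¹ : ℝ) • y, inner ℝ ((‖y‖⁻¹ : ℝ) • y) w, ?_, fun v hv hne => ?_⟩
  · rw [norm_smul, norm_inv, norm_norm, inv_mul_cancel₀ hyn]
  · have hmem : v - w ∈ W := vsub_mem_vectorSpan ℝ
      (by simpa using ⟨hv, hne⟩) (by simpa [and_comm] using hw)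
    have h0 : inner ℝ y (v - w) = 0 := (Submodule.mem_orthogonal' W y).1 hy _ hmem
    rw [inner_sub_right] at h0
    rw [real_inner_smul_left, real_inner_smul_left, sub_eq_zero.1 h0]

/-- Every `d + 1` vectors admit a nontrivial linear relation with nonnegative total weight. -/
lemma exists_relation {d : ℕ} {ω : Finset (EuclideanSpace ℝ (Fin d))} (hcard : ω.card = d + 1) :
    ∃ c : EuclideanSpace ℝ (Fin d) → ℝ, ∑ v ∈ ω, c v • v = 0 ∧ (∃ v ∈ ω, c v ≠ 0) ∧
      0 ≤ ∑ v ∈ ω, c v := by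
  obtain ⟨c, hc, hne⟩ := Module.exists_nontrivial_relation_of_finrank_lt_card (R := ℝ) (t := ω)
    (by rw [finrank_euclideanSpace_fin, hcard]; omega)
  rcases le_total 0 (∑ v ∈ ω, c v) with h | h
  · exact ⟨c, hc, hne, h⟩
  · refine ⟨fun v => -c v, ?_, ?_, ?_⟩
    · simp only [neg_smul, Finset.sum_neg_distrib, hc, neg_zero]
    · simpa using hne
    · simpa [Finset.sum_neg_distrib] using h

/-- At a vertex of minimal weight, the outer normal of the opposite facet is far from that vertex
relative to its distance to the facet. -/
lemma exists_unit_inner_le {d : ℕ} (hd : 1 ≤ d) {ω : Finset (EuclideanSpace ℝ (Fin d))}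
    (hω : IsConfig d ω) {c : EuclideanSpace ℝ (Fin d) → ℝ} (hc : ∑ v ∈ ω, c v • v = 0)
    (hne : ∃ v ∈ ω, c v ≠ 0) (hsum : 0 ≤ ∑ v ∈ ω, c v) {v₀ : EuclideanSpace ℝ (Fin d)}
    (h₀ : v₀ ∈ ω) (hmin : ∀ v ∈ ω, c v₀ ≤ c v) :
    ∃ (x : EuclideanSpace ℝ (Fin d)) (s : ℝ), ‖x‖ = 1 ∧ 0 ≤ s ∧ s ≤ 1 ∧ inner ℝ x v₀ ≤ -s ∧
      ∀ v ∈ ω, v ≠ v₀ → inner ℝ x v ≤ s / d := by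
  classical
  have hd' : (0 : ℝ) < d := by exact_mod_cast hd
  obtain ⟨x, r, hx, hr⟩ := exists_unit_inner_const hω.2 hd h₀
  set S := ∑ v ∈ ω, c v with hS
  have key : ∀ (x : EuclideanSpace ℝ (Fin d)) (r : ℝ), (∀ v ∈ ω, v ≠ v₀ → inner ℝ x v = r) →
      c v₀ * inner ℝ x v₀ + (S - c v₀) * r = 0 := by
    intro x r hr
    have h1 : ∑ v ∈ ω, c v * inner ℝ x v = 0 := by
      have := congrArg (inner ℝ x) hc
      simpa [inner_sum, real_inner_smul_right] using this
    rw [← Finset.add_sum_erase _ _ h₀] at h1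
    rw [Finset.sum_congr rfl (fun v hv => by
      rw [hr v (Finset.mem_of_mem_erase hv) (Finset.ne_of_mem_erase hv)]),
      ← Finset.sum_mul] at h1
    rw [hS, ← Finset.add_sum_erase _ _ h₀]
    linarith
  have hneg : ∀ v ∈ ω, v ≠ v₀ → inner ℝ (-x) v = -r := fun v hv hne => by
    rw [inner_neg_left, hr v hv hne]
  have hcardS : (d + 1 : ℝ) * c v₀ ≤ S := by
    have := Finset.card_nsmul_le_sum ω c (c v₀) hmin
    rw [hω.2, nsmul_eq_mul] at this
    exact_mod_cast this
  have hkx := key x r hr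
  have hSpos : 0 ≤ c v₀ → 0 < S := by
    intro h
    obtain ⟨v, hv, hvne⟩ := hne
    exact Finset.sum_pos' (fun w hw => h.trans (hmin w hw))
      ⟨v, hv, lt_of_le_of_ne (h.trans (hmin v hv)) (Ne.symm hvne)⟩
  -- Only the sign of the normal is free. If `c v₀ ≤ 0`, then `s = 0` works; here `S - c v₀ > 0`,
  -- which is where the nonnegative total weight and the nontriviality enter. If `c v₀ > 0`, take `s
  -- = -⟪y, v₀⟫`.
  rcases lt_trichotomy (c v₀) 0 with h | h | h
  · obtain ⟨y, q, hy, hq, hq0⟩ : ∃ (y : EuclideanSpace ℝ (Fin d)) (q : ℝ), ‖y‖ = 1 ∧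
        (∀ v ∈ ω, v ≠ v₀ → inner ℝ y v = q) ∧ q ≤ 0 := by
      rcases le_total r 0 with h' | h'
      · exact ⟨x, r, hx, hr, h'⟩
      · exact ⟨-x, -r, by rwa [norm_neg], hneg, by linarith⟩
    refine ⟨y, 0, hy, le_rfl, zero_le_one, ?_, fun v hv hne => ?_⟩
    · have := key y q hq
      by_contra! hcon
      nlinarith
    · rw [hq v hv hne, zero_div]; exact hq0
  · have hr0 : r = 0 := by
      have := hSpos h.ge
      rw [h] at hkx
      have : S * r = 0 := by linarith
      rcases mul_eq_zero.1 this with h' | h' <;> linarith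
    rcases le_total (inner ℝ x v₀) 0 with h' | h'
    · exact ⟨x, 0, hx, le_rfl, zero_le_one, by simpa using h', fun v hv hne => by
        rw [hr v hv hne, hr0, zero_div]⟩
    · exact ⟨-x, 0, by rwa [norm_neg], le_rfl, zero_le_one, by
        rw [inner_neg_left]; linarith, fun v hv hne => by
        rw [hneg v hv hne, hr0, zero_div, neg_zero]⟩
  · obtain ⟨y, q, hy, hq, hq0⟩ : ∃ (y : EuclideanSpace ℝ (Fin d)) (q : ℝ), ‖y‖ = 1 ∧
        (∀ v ∈ ω, v ≠ v₀ → inner ℝ y v = q) ∧ 0 ≤ q := by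
      rcases le_total 0 r with h' | h'
      · exact ⟨x, r, hx, hr, h'⟩
      · exact ⟨-x, -r, by rwa [norm_neg], hneg, by linarith⟩
    have hk := key y q hq
    have hv₀ : ‖v₀‖ = 1 := mem_unitSphere_iff.1 (hω.1 h₀)
    have habs : |inner ℝ y v₀| ≤ 1 := by
      simpa [hy, hv₀] using abs_real_inner_le_norm y v₀
    -- Minimality gives `S - c v₀ ≥ d * c v₀`; multiply by `q ≥ 0` and use `hk`.
    have hle : d * q ≤ - inner ℝ y v₀ := by
      have h1 : (d * q) * c v₀ ≤ (- inner ℝ y v₀) * c v₀ := by nlinarith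
      exact le_of_mul_le_mul_right h1 h
    refine ⟨y, -inner ℝ y v₀, hy, ?_, by linarith [(abs_le.1 habs).1], by simp,
      fun v hv hne => ?_⟩
    · exact (mul_nonneg hd'.le hq0).trans hle
    · rw [hq v hv hne, le_div_iff₀ hd']; linarith

/-! ### Regular simplices: Gram matrix, existence, moments -/

lemma IsRegularSimplex.isConfig {d : ℕ} {ω : Finset (EuclideanSpace ℝ (Fin d))}
    (h : IsRegularSimplex d ω) : IsConfig d ω := by
  classical
  obtain ⟨h1, s, -, hs⟩ := h
  refine ⟨h1, ?_⟩
  have : ω = Finset.univ.image s.points := by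
    apply Finset.coe_injective; simp [hs]
  rw [this, Finset.card_image_of_injective _ s.independent.injective]
  simp

/-- Distinct vertices of an inscribed regular simplex have inner product `-1/d`. -/
lemma IsRegularSimplex.inner_eq {d : ℕ} (hd : 1 ≤ d) {ω : Finset (EuclideanSpace ℝ (Fin d))}
    (h : IsRegularSimplex d ω) {v w : EuclideanSpace ℝ (Fin d)} (hv : v ∈ ω) (hw : w ∈ ω)
    (hvw : v ≠ w) : inner ℝ v w = -1 / (d : ℝ) := by
  classical
  have hcfg := h.isConfig
  have hd' : (0 : ℝ) < d := by exact_mod_cast hd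
  obtain ⟨h1, s, ⟨r, hr⟩, hs⟩ := h
  have hn : ∀ v ∈ ω, ‖v‖ = 1 := fun v hv => mem_unitSphere_iff.1 (h1 hv)
  have hin : ∀ v ∈ ω, ∀ w ∈ ω, v ≠ w → inner ℝ v w = 1 - r ^ 2 / 2 := by
    intro v hv w hw hne
    obtain ⟨i, rfl⟩ : v ∈ Set.range s.points := hs ▸ hv
    obtain ⟨j, rfl⟩ : w ∈ Set.range s.points := hs ▸ hw
    have h2 := hr i j (fun hij => hne (by rw [hij]))
    rw [dist_eq_norm] at h2
    have h3 := norm_sub_sq_of_mem_unitSphere (hn _ hv) (hn _ hw)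
    rw [h2] at h3
    linarith
  have hr0 : r ^ 2 ≠ 0 := by
    intro h0
    obtain ⟨i, rfl⟩ : v ∈ Set.range s.points := hs ▸ hv
    obtain ⟨j, rfl⟩ : w ∈ Set.range s.points := hs ▸ hw
    have h2 := hr i j (fun hij => hvw (by rw [hij]))
    rw [pow_eq_zero_iff two_ne_zero] at h0
    rw [h0, dist_eq_zero] at h2
    exact hvw h2
  -- A linear relation must exist in dimension `d`; pairing it with each vertex makes its weights
  -- equal and thereby fixes the edge length `r`.
  obtain ⟨c, hc, ⟨u, hu, hu0⟩, -⟩ := exists_relation hcfg.2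
  set S := ∑ v ∈ ω, c v with hS
  have key : ∀ w ∈ ω, c w * (r ^ 2 / 2) + (1 - r ^ 2 / 2) * S = 0 := by
    intro w hw
    have h2 : ∑ v ∈ ω, c v * inner ℝ w v = 0 := by
      have := congrArg (inner ℝ w) hc
      simpa [inner_sum, real_inner_smul_right] using this
    rw [← Finset.add_sum_erase _ _ hw] at h2
    rw [Finset.sum_congr rfl (fun v hv => by
      rw [hin w hw v (Finset.mem_of_mem_erase hv) (Finset.ne_of_mem_erase hv).symm]),
      ← Finset.sum_mul, real_inner_self_eq_norm_sq, hn w hw] at h2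
    rw [hS, ← Finset.add_sum_erase _ _ hw]
    linarith
  have hconst : ∀ w ∈ ω, c w = c u := by
    intro w hw
    have h2 := key w hw
    have h3 := key u hu
    have : (c w - c u) * r ^ 2 = 0 := by linarith
    rcases mul_eq_zero.1 this with h4 | h4
    · linarith
    · exact absurd h4 hr0
  have hSu : S = (d + 1) * c u := by
    rw [hS, Finset.sum_congr rfl hconst, Finset.sum_const, hcfg.2, nsmul_eq_mul]; push_cast; ring
  have h2 := key u hu
  rw [hSu] at h2
  have h3 : r ^ 2 / 2 + (1 - r ^ 2 / 2) * (d + 1) = 0 := by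
    have : c u * (r ^ 2 / 2 + (1 - r ^ 2 / 2) * (d + 1)) = 0 := by linarith
    exact (mul_eq_zero.1 this).resolve_left hu0
  rw [hin v hv w hw hvw, eq_div_iff hd'.ne']
  linarith

lemma isRegularSimplex_of_inner_eq {d : ℕ} (hd : 1 ≤ d)
    {ω : Finset (EuclideanSpace ℝ (Fin d))} (hω : IsConfig d ω)
    (hin : ∀ v ∈ ω, ∀ w ∈ ω, v ≠ w → inner ℝ v w = -1 / (d : ℝ)) : IsRegularSimplex d ω := by
  classical
  have hd' : (0 : ℝ) < d := by exact_mod_cast hd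
  have hn : ∀ v ∈ ω, ‖v‖ = 1 := fun v hv => mem_unitSphere_iff.1 (hω.1 hv)
  refine ⟨hω.1, ?_⟩
  have hcard : Fintype.card ω = d + 1 := by rw [Fintype.card_coe, hω.2]
  let e : Fin (d + 1) ≃ ω := (Fintype.equivFinOfCardEq hcard).symm
  let p : Fin (d + 1) → EuclideanSpace ℝ (Fin d) := fun i => e i
  have hp : ∀ i, p i ∈ ω := fun i => (e i).2
  have hpi : Function.Injective p := fun i j hij => e.injective (Subtype.ext hij)
  have hind : AffineIndependent ℝ p := by
    rw [affineIndependent_iff]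
    intro s w hw0 hws i hi
    have h2 : ∑ j ∈ s, w j * inner ℝ (p i) (p j) = 0 := by
      have := congrArg (inner ℝ (p i)) hws
      simpa [inner_sum, real_inner_smul_right] using this
    rw [← Finset.add_sum_erase _ _ hi] at h2 hw0
    rw [Finset.sum_congr rfl (fun j hj => by
      rw [hin _ (hp i) _ (hp j) (fun h => (Finset.ne_of_mem_erase hj) (hpi h).symm)]),
      ← Finset.sum_mul, real_inner_self_eq_norm_sq, hn _ (hp i)] at h2
    have h3 : ∑ j ∈ s.erase i, w j = - w i := by linarith
    rw [h3] at h2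
    have h4 : w i * (1 + 1 / d) = 0 := by
      rw [← h2]; ring
    exact (mul_eq_zero.1 h4).resolve_right (by positivity)
  refine ⟨⟨p, hind⟩, ⟨Real.sqrt (2 + 2 / d), fun i j hij => ?_⟩, ?_⟩
  · have h2 := norm_sub_sq_of_mem_unitSphere (hn _ (hp i)) (hn _ (hp j))
    rw [hin _ (hp i) _ (hp j) (fun h => hij (hpi h))] at h2
    change dist (p i) (p j) = _
    rw [dist_eq_norm, ← Real.sqrt_sq (norm_nonneg (p i - p j)), h2]
    congr 1
    ring
  · ext v
    constructor
    · rintro ⟨i, rfl⟩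
      exact hp i
    · intro hv
      exact ⟨e.symm ⟨v, hv⟩, by simp [p]⟩

lemma exists_isRegularSimplex {d : ℕ} (hd : 1 ≤ d) :
    ∃ ω : Finset (EuclideanSpace ℝ (Fin d)), IsRegularSimplex d ω := by
  classical
  have hd' : (0 : ℝ) < d := by exact_mod_cast hd
  -- With `u` the all-ones vector, the vertices are `-k • u` and `a • eᵢ + b • u`. Here `k`
  -- normalises the first, `a + b * d = ⟪u, a • eᵢ + b • u⟫ = k` gives its products with the others,
  -- and `a ^ 2` is the gap between the diagonal and off-diagonal products.
  obtain ⟨k, hk0, hk⟩ : ∃ k : ℝ, 0 < k ∧ k ^ 2 = 1 / d :=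
    ⟨Real.sqrt (1 / d), Real.sqrt_pos.2 (by positivity), Real.sq_sqrt (by positivity)⟩
  obtain ⟨a, ha0, ha⟩ : ∃ a : ℝ, 0 < a ∧ a ^ 2 = 1 + 1 / d :=
    ⟨Real.sqrt (1 + 1 / d), Real.sqrt_pos.2 (by positivity), Real.sq_sqrt (by positivity)⟩
  obtain ⟨b, hb⟩ : ∃ b : ℝ, a + b * d = k := ⟨(k - a) / d, by field_simp; ring⟩
  let u : EuclideanSpace ℝ (Fin d) := WithLp.toLp 2 (fun _ => (1 : ℝ))
  let p : Option (Fin d) → EuclideanSpace ℝ (Fin d) := fun o =>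
    o.elim ((-k) • u) (fun i => a • EuclideanSpace.single i (1 : ℝ) + b • u)
  have huu : inner ℝ u u = (d : ℝ) := by
    simp only [u, PiLp.inner_apply]; simp
  have heu : ∀ i, inner ℝ (EuclideanSpace.single i (1 : ℝ)) u = (1 : ℝ) := by
    intro i; simp [u, EuclideanSpace.inner_single_left]
  have hue : ∀ i, inner ℝ u (EuclideanSpace.single i (1 : ℝ)) = (1 : ℝ) := by
    intro i; rw [real_inner_comm, heu]
  have hkd : k ^ 2 * d = 1 := by rw [hk]; field_simp
  have hab : 2 * a * b + b ^ 2 * d = -1 / d := by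
    have h1 : (a + b * d) ^ 2 = 1 / d := by rw [hb, hk]
    have h2 : (2 * a * b + b ^ 2 * d) * d = -1 := by
      have : a ^ 2 + (2 * a * b + b ^ 2 * d) * d = 1 / d := by rw [← h1]; ring
      linarith
    rw [eq_div_iff hd'.ne']; exact h2
  have hpp : ∀ o o', inner ℝ (p o) (p o') = if o = o' then (1 : ℝ) else -1 / d := by
    intro o o'
    rcases o with _ | i <;> rcases o' with _ | j
    · simp only [p, Option.elim, real_inner_smul_left, real_inner_smul_right, huu, if_true]
      linarith
    · simp only [p, Option.elim, real_inner_smul_left, real_inner_smul_right, inner_add_right,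
        huu, hue, reduceCtorEq, if_false]
      rw [neg_div, ← hk, ← hb]; ring
    · simp only [p, Option.elim, real_inner_smul_left, real_inner_smul_right, inner_add_left,
        huu, heu, reduceCtorEq, if_false]
      rw [neg_div, ← hk, ← hb]; ring
    · have hij : inner ℝ (EuclideanSpace.single i (1 : ℝ)) (EuclideanSpace.single j (1 : ℝ))
          = if i = j then (1 : ℝ) else 0 := by
        simp [EuclideanSpace.inner_single_left]
      simp only [p, Option.elim, real_inner_smul_left, real_inner_smul_right, inner_add_left,
        inner_add_right, huu, heu, hue, hij, Option.some.injEq]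
      split_ifs
      · have : -1 / (d : ℝ) = -(1 / d) := neg_div _ _
        nlinarith
      · linarith
  have hpi : Function.Injective p := by
    intro o o' h
    by_contra hne
    have h1 := hpp o o
    rw [if_pos rfl] at h1
    have h2 := hpp o o'
    rw [if_neg hne, ← h, h1, eq_div_iff hd'.ne'] at h2
    linarith
  refine ⟨Finset.univ.image p, isRegularSimplex_of_inner_eq hd ⟨?_, ?_⟩ ?_⟩
  · intro v hv
    simp only [Finset.coe_image, Finset.coe_univ, Set.image_univ, Set.mem_range] at hv
    obtain ⟨o, rfl⟩ := hv
    have h1 := hpp o o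
    rw [if_pos rfl, real_inner_self_eq_norm_sq] at h1
    rw [mem_unitSphere_iff]
    nlinarith [norm_nonneg (p o)]
  · rw [Finset.card_image_of_injective _ hpi]; simp
  · intro v hv w hw hne
    simp only [Finset.mem_image, Finset.mem_univ, true_and] at hv hw
    obtain ⟨o, rfl⟩ := hv
    obtain ⟨o', rfl⟩ := hw
    rw [hpp, if_neg (fun h => hne (by rw [h]))]

/-- The vertices of a regular simplex have zero sum and form a tight frame. -/
lemma IsRegularSimplex.moments {d : ℕ} (hd : 1 ≤ d) {ω : Finset (EuclideanSpace ℝ (Fin d))}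
    (h : IsRegularSimplex d ω) {x : EuclideanSpace ℝ (Fin d)} (hx : ‖x‖ = 1) :
    ∑ v ∈ ω, inner ℝ x v = 0 ∧ ∑ v ∈ ω, (inner ℝ x v) ^ 2 = ((d : ℝ) + 1) / d := by
  classical
  have hcfg := h.isConfig
  have hd' : (0 : ℝ) < d := by exact_mod_cast hd
  have hin : ∀ v ∈ ω, ∀ w ∈ ω, v ≠ w → inner ℝ v w = -1 / (d : ℝ) :=
    fun v hv w hw hne => h.inner_eq hd hv hw hne
  have hn : ∀ v ∈ ω, ‖v‖ = 1 := fun v hv => mem_unitSphere_iff.1 (h.1 hv)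
  have hinner : ∀ (c : EuclideanSpace ℝ (Fin d) → ℝ), ∀ w ∈ ω,
      inner ℝ (∑ v ∈ ω, c v • v) w = c w * (1 + 1 / d) - (∑ v ∈ ω, c v) / d := by
    intro c w hw
    rw [sum_inner, ← Finset.add_sum_erase _ _ hw, ← Finset.add_sum_erase _ c hw]
    rw [Finset.sum_congr rfl (fun v hv => by
      rw [real_inner_smul_left,
        hin v (Finset.mem_of_mem_erase hv) w hw (Finset.ne_of_mem_erase hv)]),
      ← Finset.sum_mul, real_inner_smul_left, real_inner_self_eq_norm_sq, hn w hw]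
    ring
  have hsum0 : ∑ v ∈ ω, v = 0 := by
    have h1 : ∀ w ∈ ω, inner ℝ (∑ v ∈ ω, v) w = (0 : ℝ) := by
      intro w hw
      have := hinner (fun _ => 1) w hw
      simp only [one_smul, Finset.sum_const, hcfg.2, nsmul_eq_mul] at this
      rw [this]; push_cast; field_simp; ring
    have h2 : inner ℝ (∑ v ∈ ω, v) (∑ v ∈ ω, v) = (0 : ℝ) := by
      conv_lhs => rw [inner_sum]
      exact Finset.sum_eq_zero h1
    exact inner_self_eq_zero.1 h2
  have hx0 : ∑ v ∈ ω, inner ℝ x v = 0 := by rw [← inner_sum, hsum0, inner_zero_right]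
  refine ⟨hx0, ?_⟩
  -- Barycentric coordinates of `x`: each `⟪x, v⟫` is affine in `c v`, so the sum of squares reduces
  -- to `∑ c v * ⟪x, v⟫ = ‖x‖ ^ 2`.
  obtain ⟨c, hc1, hcx⟩ : ∃ c : EuclideanSpace ℝ (Fin d) → ℝ, ∑ v ∈ ω, c v = 1 ∧
      ∑ v ∈ ω, c v • v = x := by
    obtain ⟨-, s, -, hs⟩ := h
    have htop : affineSpan ℝ (Set.range s.points) = ⊤ := by
      rw [s.independent.affineSpan_eq_top_iff_card_eq_finrank_add_one]
      simp
    have hxm : x ∈ affineSpan ℝ (Set.range s.points) := by rw [htop]; trivial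
    obtain ⟨w, hw1, hwx⟩ := eq_affineCombination_of_mem_affineSpan_of_fintype hxm
    have hωs : ω = Finset.univ.image s.points := by
      apply Finset.coe_injective; simp [hs]
    refine ⟨fun v => w (Function.invFun s.points v), ?_, ?_⟩
    · rw [hωs, Finset.sum_image (fun _ _ _ _ hij => s.independent.injective hij), ← hw1]
      exact Finset.sum_congr rfl fun i _ => by
        rw [Function.leftInverse_invFun s.independent.injective i]
    · rw [hωs, Finset.sum_image (fun _ _ _ _ hij => s.independent.injective hij), hwx,
        Finset.affineCombination_eq_linear_combination _ _ _ hw1]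
      exact Finset.sum_congr rfl fun i _ => by
        beta_reduce
        rw [Function.leftInverse_invFun s.independent.injective i]
  have h1 : ∀ w ∈ ω, inner ℝ x w = c w * (1 + 1 / d) - 1 / d := by
    intro w hw
    have := hinner c w hw
    rwa [hcx, hc1] at this
  have h2 : ∑ v ∈ ω, c v * inner ℝ x v = 1 := by
    have : inner ℝ x (∑ v ∈ ω, c v • v) = (1 : ℝ) := by
      rw [hcx, real_inner_self_eq_norm_sq, hx, one_pow]
    simpa [inner_sum, real_inner_smul_right] using this
  calc ∑ v ∈ ω, (inner ℝ x v) ^ 2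
      = ∑ v ∈ ω, ((1 + 1 / (d : ℝ)) * (c v * inner ℝ x v) - 1 / d * inner ℝ x v) :=
        Finset.sum_congr rfl fun v hv => by rw [pow_two]; nth_rw 1 [h1 v hv]; ring
    _ = (1 + 1 / (d : ℝ)) * 1 - 1 / d * 0 := by
        rw [Finset.sum_sub_distrib, ← Finset.mul_sum, ← Finset.mul_sum, h2, hx0]
    _ = ((d : ℝ) + 1) / d := by field_simp; ring

end Polarization

/-! ### One-variable facts about `f` -/

namespace Polarization

namespace IsAdmissible

variable {f : ℝ → EReal}

lemma coe_toReal (hf : IsAdmissible f) {t : ℝ} (ht : t ∈ Ioc (0 : ℝ) 4) :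
    ((f t).toReal : EReal) = f t :=
  EReal.coe_toReal (hf.ne_top t ht) (hf.ne_bot t (Ioc_subset_Icc_self ht))

lemma toReal_antitone (hf : IsAdmissible f) :
    AntitoneOn (fun t => (f t).toReal) (Ioc (0 : ℝ) 4) := fun x hx y hy hxy => by
  have := hf.antitone hx hy hxy
  rwa [← hf.coe_toReal hx, ← hf.coe_toReal hy, EReal.coe_le_coe_iff] at this

/-- At `0` the extended limit is used, at `4` monotonicity alone suffices, and in between
differentiability gives continuity. -/
lemma lowerSemicontinuousOn (hf : IsAdmissible f) : LowerSemicontinuousOn f (Icc 0 4) := by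
  intro t ht y hy
  rcases eq_or_lt_of_le ht.1 with rfl | h0
  · have h1 : ∀ᶠ s in 𝓝[>] (0 : ℝ), y < f s := hf.tendsto_zero.eventually_const_lt hy
    have h2 : ∀ᶠ s in 𝓝[≥] (0 : ℝ), y < f s := by
      rw [← Ioi_insert, nhdsWithin_insert]
      exact eventually_sup.2 ⟨eventually_pure.2 hy, h1⟩
    exact h2.filter_mono (nhdsWithin_mono _ Icc_subset_Ici_self)
  · rcases eq_or_lt_of_le ht.2 with rfl | h4
    · filter_upwards [self_mem_nhdsWithin, mem_nhdsWithin_of_mem_nhds (lt_mem_nhds h0)] with s hs h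
      exact hy.trans_le (hf.antitone ⟨h, hs.2⟩ ⟨h0, ht.2⟩ hs.2)
    · have hc : ContinuousAt f t := by
        have h1 : ContinuousAt (fun s => ((f s).toReal : EReal)) t :=
          continuous_coe_real_ereal.continuousAt.comp (hf.differentiable t ⟨h0, h4⟩).continuousAt
        refine h1.congr ?_
        filter_upwards [Ioo_mem_nhds h0 h4] with s hs
        exact hf.coe_toReal (Ioo_subset_Ioc_self hs)
      exact (hc.tendsto.eventually_const_lt hy).filter_mono nhdsWithin_le_nhds

end IsAdmissible

/-- The value at the midpoint is at least `F y` and strictly below the average of `F x` and `F y`.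
-/
lemma strictAntiOn_of_strictConvexOn {F : ℝ → ℝ} {s : Set ℝ} (ha : AntitoneOn F s)
    (hc : StrictConvexOn ℝ s F) : StrictAntiOn F s := by
  intro x hx y hy hxy
  have hm := hc.2 hx hy hxy.ne (by norm_num : (0 : ℝ) < 1 / 2) (by norm_num : (0 : ℝ) < 1 / 2)
    (by norm_num)
  have hmem : (1 / 2 : ℝ) • x + (1 / 2 : ℝ) • y ∈ s :=
    hc.1 hx hy (by norm_num) (by norm_num) (by norm_num)
  have := ha hmem hy (by simp only [smul_eq_mul]; linarith)
  simp only [smul_eq_mul] at *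
  linarith

section Comparison

variable {F : ℝ → ℝ} {d : ℕ}

lemma two_sub_two_div_mem (hd : 2 ≤ d) : 2 - 2 / (d : ℝ) ∈ Ico (1 : ℝ) 2 := by
  have hd' : (2 : ℝ) ≤ d := by exact_mod_cast hd
  have h1 : 2 / (d : ℝ) ≤ 1 := by rw [div_le_one (by linarith)]; exact hd'
  have h2 : 0 < 2 / (d : ℝ) := by positivity
  constructor <;> linarith

lemma two_sub_eq_combination (hd : 2 ≤ d) (s : ℝ) :
    2 - 2 * (s / d) = (1 - (1 - s) / (d + 1)) * (2 - 2 / (d : ℝ)) + (1 - s) / (d + 1) * 4 := by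
  have hd' : (0 : ℝ) < d := by exact_mod_cast (by omega : 0 < d)
  field_simp
  ring

lemma two_add_eq_combination (hd : 2 ≤ d) (s : ℝ) :
    2 + 2 * s = d * ((1 - s) / (d + 1)) * (2 - 2 / (d : ℝ)) +
      (1 - d * ((1 - s) / (d + 1))) * 4 := by
  have hd' : (0 : ℝ) < d := by exact_mod_cast (by omega : 0 < d)
  field_simp
  ring

lemma weight_bounds (hd : 2 ≤ d) {s : ℝ} (h0 : 0 ≤ s) (h1 : s ≤ 1) :
    0 ≤ (1 - s) / ((d : ℝ) + 1) ∧ (1 - s) / ((d : ℝ) + 1) < 1 ∧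
      d * ((1 - s) / ((d : ℝ) + 1)) < 1 := by
  have hd' : (0 : ℝ) < d := by exact_mod_cast (by omega : 0 < d)
  refine ⟨div_nonneg (by linarith) (by positivity), ?_, ?_⟩
  · rw [div_lt_one (by positivity)]; linarith
  · rw [← mul_div_assoc, div_lt_one (by positivity)]; nlinarith

/-- With `μ = (1 - s)/(d + 1)`, both arguments on the left are convex combinations of `2 - 2/d` and
`4`. The total weights, `d` on `2 - 2/d` and `1` on `4`, are those on the right. -/
lemma convex_comparison (hd : 2 ≤ d) (hF : ConvexOn ℝ (Ioc (0 : ℝ) 4) F) {s : ℝ} (h0 : 0 ≤ s)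
    (h1 : s ≤ 1) :
    d * F (2 - 2 * (s / d)) + F (2 + 2 * s) ≤ F 4 + d * F (2 - 2 / (d : ℝ)) := by
  have ha := two_sub_two_div_mem hd
  have ham : 2 - 2 / (d : ℝ) ∈ Ioc (0 : ℝ) 4 := ⟨by linarith [ha.1], by linarith [ha.2]⟩
  have h4m : (4 : ℝ) ∈ Ioc (0 : ℝ) 4 := by norm_num
  obtain ⟨w0, w1, w2⟩ := weight_bounds hd h0 h1
  rw [two_sub_eq_combination hd, two_add_eq_combination hd]
  set μ := (1 - s) / ((d : ℝ) + 1)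
  have e1 := hF.2 ham h4m (sub_nonneg.2 w1.le) w0 (sub_add_cancel 1 μ)
  have e2 := hF.2 ham h4m (mul_nonneg (Nat.cast_nonneg d) w0) (sub_nonneg.2 w2.le)
    (add_sub_cancel _ _)
  simp only [smul_eq_mul] at e1 e2
  have e3 := mul_le_mul_of_nonneg_left e1 (Nat.cast_nonneg (α := ℝ) d)
  linarith

lemma strictConvex_comparison (hd : 2 ≤ d) (hF : StrictConvexOn ℝ (Ioc (0 : ℝ) 4) F) {s : ℝ}
    (h0 : 0 ≤ s) (h1 : s < 1) :
    d * F (2 - 2 * (s / d)) + F (2 + 2 * s) < F 4 + d * F (2 - 2 / (d : ℝ)) := by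
  have ha := two_sub_two_div_mem hd
  have ham : 2 - 2 / (d : ℝ) ∈ Ioc (0 : ℝ) 4 := ⟨by linarith [ha.1], by linarith [ha.2]⟩
  have h4m : (4 : ℝ) ∈ Ioc (0 : ℝ) 4 := by norm_num
  have hd' : (0 : ℝ) < d := by exact_mod_cast (by omega : 0 < d)
  obtain ⟨-, w1, w2⟩ := weight_bounds hd h0 h1.le
  have w0 : 0 < (1 - s) / ((d : ℝ) + 1) := div_pos (by linarith) (by positivity)
  rw [two_sub_eq_combination hd, two_add_eq_combination hd]
  set μ := (1 - s) / ((d : ℝ) + 1)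
  have e1 := hF.2 ham h4m (by linarith [ha.2] : 2 - 2 / (d : ℝ) < 4).ne (sub_pos.2 w1) w0
    (sub_add_cancel 1 μ)
  have e2 := hF.convexOn.2 ham h4m (mul_pos hd' w0).le (sub_nonneg.2 w2.le) (add_sub_cancel _ _)
  simp only [smul_eq_mul] at e1 e2
  have e3 := mul_lt_mul_of_pos_left e1 hd'
  linarith

end Comparison

/-- Convexity settles interior points. At `b`, monotonicity bounds `F` from below and the chord over
`[b/2, b]` from above. -/
lemma continuousOn_Ioc_of_convexOn_of_antitoneOn {F : ℝ → ℝ} {b : ℝ} (hb : 0 < b)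
    (hF : ConvexOn ℝ (Ioc 0 b) F) (hanti : AntitoneOn F (Ioc 0 b)) :
    ContinuousOn F (Ioc 0 b) := by
  intro t ht
  rcases eq_or_lt_of_le ht.2 with rfl | htb
  · have hm : t / 2 ∈ Ioc (0 : ℝ) t := ⟨by linarith, by linarith⟩
    have hlim : Tendsto (fun s => F t + (t - s) / (t / 2) * (F (t / 2) - F t)) (𝓝[Ioc 0 t] t)
        (𝓝 (F t)) := by
      have : Tendsto (fun s => F t + (t - s) / (t / 2) * (F (t / 2) - F t)) (𝓝 t)
          (𝓝 (F t + (t - t) / (t / 2) * (F (t / 2) - F t))) := by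
        apply Continuous.tendsto
        fun_prop
      rw [sub_self, zero_div, zero_mul, add_zero] at this
      exact this.mono_left nhdsWithin_le_nhds
    refine tendsto_of_tendsto_of_tendsto_of_le_of_le' tendsto_const_nhds hlim ?_ ?_
    · filter_upwards [self_mem_nhdsWithin] with s hs
      exact hanti hs ht hs.2
    · filter_upwards [self_mem_nhdsWithin,
        mem_nhdsWithin_of_mem_nhds (lt_mem_nhds (by linarith : t / 2 < t))] with s hs hs2
      have hw : 0 ≤ (t - s) / (t / 2) := div_nonneg (by linarith [hs.2]) (by linarith)
      have hw1 : (t - s) / (t / 2) ≤ 1 := by rw [div_le_one (by linarith)]; linarith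
      have h := hF.2 hm ht hw (sub_nonneg.2 hw1) (add_sub_cancel _ _)
      have he : (t - s) / (t / 2) * (t / 2) + (1 - (t - s) / (t / 2)) * t = s := by
        field_simp; ring
      simp only [smul_eq_mul] at h
      rw [he] at h
      linarith
  · have h1 : ContinuousOn F (Ioo 0 b) :=
      (hF.subset Ioo_subset_Ioc_self (convex_Ioo 0 b)).continuousOn isOpen_Ioo
    exact (h1.continuousAt (Ioo_mem_nhds ht.1 htb)).continuousWithinAt

/-- The quadratic Hermite interpolant at `a` (twice) and at the right end point lies below a
function with concave derivative. -/
lemma exists_quadratic_le {F : ℝ → ℝ} {a b : ℝ} (ha : 0 < a) (hab : a < b)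
    (hcont : ContinuousOn F (Ioc 0 b)) (hdiff : ∀ t ∈ Ioo 0 b, DifferentiableAt ℝ F t)
    (hconc : ConcaveOn ℝ (Ioo 0 b) (deriv F)) :
    ∃ A B C : ℝ, (∀ t ∈ Ioc 0 b, A * t ^ 2 + B * t + C ≤ F t) ∧ A * a ^ 2 + B * a + C = F a ∧
      A * b ^ 2 + B * b + C = F b := by
  -- `K` makes the quadratic tangent at `a` agree with `F` at `b`.
  obtain ⟨K, hK⟩ : ∃ K : ℝ, F a + deriv F a * (b - a) + K * (b - a) ^ 2 = F b :=
    ⟨(F b - F a - deriv F a * (b - a)) / (b - a) ^ 2, by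
      have : b - a ≠ 0 := by linarith
      field_simp; ring⟩
  set φ : ℝ → ℝ := fun t => F t - (F a + deriv F a * (t - a) + K * (t - a) ^ 2) with hφ
  set ψ : ℝ → ℝ := fun t => deriv F t - (deriv F a + 2 * K * (t - a)) with hψ
  have hφd : ∀ t ∈ Ioo 0 b, HasDerivAt φ (ψ t) t := by
    intro t ht
    have h1 : HasDerivAt (fun t : ℝ => t - a) 1 t := (hasDerivAt_id t).sub_const a
    have h2 := (hdiff t ht).hasDerivAt.sub
      (((h1.const_mul (deriv F a)).const_add (F a)).add ((h1.pow 2).const_mul K))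
    refine h2.congr_deriv ?_
    simp only [hψ]
    norm_num
    ring
  have hφc : ContinuousOn φ (Ioc 0 b) := hcont.sub (by fun_prop)
  have hψc : ConcaveOn ℝ (Ioo 0 b) ψ := by
    refine ⟨convex_Ioo 0 b, fun x hx y hy p q hp hq hpq => ?_⟩
    have h1 := hconc.2 hx hy hp hq hpq
    simp only [smul_eq_mul, hψ] at h1 ⊢
    obtain rfl : q = 1 - p := by linarith
    linarith
  have hφa : φ a = 0 := by simp [hφ]
  have hφb : φ b = 0 := by simp only [hφ]; linarith
  have hψa : ψ a = 0 := by simp [hψ]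
  have ham : a ∈ Ioo 0 b := ⟨ha, hab⟩
  -- Rolle yields a second zero of the concave `ψ`. Hence `ψ ≤ 0` before `a`, `ψ ≥ 0` on `[a, c]`
  -- and `ψ ≤ 0` after `c`; with `φ a = φ b = 0` this gives `φ ≥ 0`.
  obtain ⟨c, hc, hc0⟩ := exists_hasDerivAt_eq_zero (f := φ) (f' := ψ) hab
    (hφc.mono fun t ht => ⟨ha.trans_le ht.1, ht.2⟩) (by rw [hφa, hφb])
    fun t ht => hφd t ⟨ha.trans ht.1, ht.2⟩
  have hcm : c ∈ Ioo 0 b := ⟨ha.trans hc.1, hc.2⟩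
  have hdv : ∀ t ∈ Ioo 0 b, deriv φ t = ψ t := fun t ht => (hφd t ht).deriv
  have hpos : ∀ t ∈ Ioc 0 b, 0 ≤ φ t := by
    intro t ht
    rcases le_total t a with hta | hta
    · have hanti : AntitoneOn φ (Ioc 0 a) := by
        refine antitoneOn_of_deriv_nonpos (convex_Ioc 0 a)
          (hφc.mono (Ioc_subset_Ioc_right hab.le)) ?_ ?_ <;> rw [interior_Ioc]
        · exact fun s hs => (hφd s ⟨hs.1, hs.2.trans hab⟩).differentiableAt.differentiableWithinAt
        · intro s hs
          have hsm : s ∈ Ioo 0 b := ⟨hs.1, hs.2.trans hab⟩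
          rw [hdv s hsm]
          have h := hψc.slope_anti_adjacent hsm hcm hs.2 hc.1
          rw [hψa, hc0, sub_zero, zero_div, le_div_iff₀ (by linarith [hs.2])] at h
          linarith
      rw [← hφa]
      exact hanti ⟨ht.1, hta⟩ ⟨ha, le_rfl⟩ hta
    rcases le_total t c with htc | htc
    · have hmono : MonotoneOn φ (Icc a c) := by
        refine monotoneOn_of_deriv_nonneg (convex_Icc a c)
          (hφc.mono fun s hs => ⟨ha.trans_le hs.1, hs.2.trans hc.2.le⟩) ?_ ?_ <;>
          rw [interior_Icc]
        · exact fun s hs => (hφd s ⟨ha.trans hs.1,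
            hs.2.trans hc.2⟩).differentiableAt.differentiableWithinAt
        · intro s hs
          have hsm : s ∈ Ioo 0 b := ⟨ha.trans hs.1, hs.2.trans hc.2⟩
          rw [hdv s hsm]
          have h := hψc.slope_anti_adjacent ham hcm hs.1 hs.2
          rw [hψa, hc0] at h
          by_contra! hneg
          have h1 : 0 < (0 - ψ s) / (c - s) := div_pos (by linarith) (by linarith [hs.2])
          have h2 : (ψ s - 0) / (s - a) < 0 := div_neg_of_neg_of_pos (by linarith)
            (by linarith [hs.1])
          linarith
      rw [← hφa]
      exact hmono ⟨le_rfl, hc.1.le⟩ ⟨hta, htc⟩ hta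
    · have hanti : AntitoneOn φ (Icc c b) := by
        refine antitoneOn_of_deriv_nonpos (convex_Icc c b)
          (hφc.mono fun s hs => ⟨hcm.1.trans_le hs.1, hs.2⟩) ?_ ?_ <;> rw [interior_Icc]
        · exact fun s hs => (hφd s ⟨hcm.1.trans hs.1,
            hs.2⟩).differentiableAt.differentiableWithinAt
        · intro s hs
          have hsm : s ∈ Ioo 0 b := ⟨hcm.1.trans hs.1, hs.2⟩
          rw [hdv s hsm]
          have h := hψc.slope_anti_adjacent ham hsm hc.1 hs.1
          rw [hψa, hc0, sub_zero, sub_zero, zero_div, div_le_iff₀ (by linarith [hs.1])] at h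
          linarith
      rw [← hφb]
      exact hanti ⟨htc, ht.2⟩ ⟨hc.2.le, le_rfl⟩ ht.2
  refine ⟨K, deriv F a - 2 * K * a, F a - deriv F a * a + K * a ^ 2, fun t ht => ?_, by ring, ?_⟩
  · have := hpos t ht
    simp only [hφ] at this
    linarith
  · rw [← hK]; ring

end Polarization

/-! ### Potentials on the sphere and attainment of the minimum -/

namespace Polarization

variable {d : ℕ} {f : ℝ → EReal} {ω : Finset (EuclideanSpace ℝ (Fin d))}

lemma coe_sum_ereal {ι : Type*} (s : Finset ι) (g : ι → ℝ) :
    ((∑ i ∈ s, g i : ℝ) : EReal) = ∑ i ∈ s, (g i : EReal) := by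
  classical
  induction s using Finset.induction_on with
  | empty => simp
  | insert a s ha ih => rw [Finset.sum_insert ha, Finset.sum_insert ha, EReal.coe_add, ih]

lemma norm_sub_sq_mem_Icc {x v : EuclideanSpace ℝ (Fin d)} (hx : ‖x‖ = 1) (hv : ‖v‖ = 1) :
    ‖x - v‖ ^ 2 ∈ Icc (0 : ℝ) 4 := by
  have h := norm_sub_le x v
  rw [hx, hv] at h
  exact ⟨sq_nonneg _, by nlinarith [norm_nonneg (x - v)]⟩

lemma potential_eq_coe (hf : IsAdmissible f) {x : EuclideanSpace ℝ (Fin d)}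
    (h : ∀ v ∈ ω, ‖x - v‖ ^ 2 ∈ Ioc (0 : ℝ) 4) :
    potential f ω x = ((∑ v ∈ ω, (f (‖x - v‖ ^ 2)).toReal : ℝ) : EReal) := by
  rw [potential, coe_sum_ereal]
  exact Finset.sum_congr rfl fun v hv => (hf.coe_toReal (h v hv)).symm

lemma potential_lowerSemicontinuousOn (hf : IsAdmissible f)
    (hω : (ω : Set (EuclideanSpace ℝ (Fin d))) ⊆ unitSphere d) :
    LowerSemicontinuousOn (potential f ω) (unitSphere d) := by
  classical
  unfold potential
  -- Addition in `EReal` is discontinuous only at `⊤ + ⊥`, so the induction also carries that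
  -- partial sums avoid `⊥`.
  suffices h : ∀ s ⊆ ω, LowerSemicontinuousOn
      (fun x => ∑ v ∈ s, f (‖x - v‖ ^ 2)) (unitSphere d) ∧
      ∀ x ∈ unitSphere d, ∑ v ∈ s, f (‖x - v‖ ^ 2) ≠ ⊥ from (h ω subset_rfl).1
  intro s
  induction s using Finset.induction_on with
  | empty =>
    intro _
    simpa using lowerSemicontinuousOn_const
  | insert a s ha ih =>
    intro hs
    obtain ⟨ih1, ih2⟩ := ih ((Finset.subset_insert a s).trans hs)
    have han : ‖a‖ = 1 := mem_unitSphere_iff.1 (hω (hs (Finset.mem_insert_self a s)))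
    have hmap : MapsTo (fun x : EuclideanSpace ℝ (Fin d) => ‖x - a‖ ^ 2) (unitSphere d)
        (Icc (0 : ℝ) 4) := fun x hx => norm_sub_sq_mem_Icc (mem_unitSphere_iff.1 hx) han
    have h1 : LowerSemicontinuousOn (fun x => f (‖x - a‖ ^ 2)) (unitSphere d) :=
      hf.lowerSemicontinuousOn.comp (by fun_prop) hmap
    have h2 : ∀ x ∈ unitSphere d, f (‖x - a‖ ^ 2) ≠ ⊥ := fun x hx => hf.ne_bot _ (hmap hx)
    simp only [Finset.sum_insert ha]
    refine ⟨h1.add' ih1 fun x hx => ?_, fun x hx => ?_⟩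
    · exact EReal.continuousAt_add (Or.inr (ih2 x hx)) (Or.inl (h2 x hx))
    · rw [Ne, EReal.add_eq_bot_iff]
      exact not_or.2 ⟨h2 x hx, ih2 x hx⟩

lemma exists_potential_eq_minPotential (hf : IsAdmissible f) (hω : IsConfig d ω) :
    ∃ x ∈ unitSphere d, potential f ω x = minPotential f ω := by
  have hne : (unitSphere d).Nonempty := by
    obtain ⟨v, hv⟩ : ω.Nonempty := Finset.card_pos.1 (by rw [hω.2]; omega)
    exact ⟨v, hω.1 hv⟩
  obtain ⟨x, hx, hmin⟩ := (potential_lowerSemicontinuousOn hf hω.1).exists_isMinOn hne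
    (isCompact_sphere _ _)
  refine ⟨x, hx, le_antisymm (le_sInf ?_) (sInf_le ⟨x, hx, rfl⟩)⟩
  rintro _ ⟨y, hy, rfl⟩
  exact hmin hy

lemma minPotential_le {x : EuclideanSpace ℝ (Fin d)} (hx : ‖x‖ = 1) :
    minPotential f ω ≤ potential f ω x :=
  sInf_le ⟨x, mem_unitSphere_iff.2 hx, rfl⟩

/-- The value of the polarization problem, as a real number. -/
noncomputable def optimalValue (d : ℕ) (f : ℝ → EReal) : ℝ :=
  (f 4).toReal + d * (f (2 - 2 / (d : ℝ))).toReal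

lemma coe_optimalValue (hd : 2 ≤ d) (hf : IsAdmissible f) :
    (optimalValue d f : EReal) = f 4 + (d : EReal) * f (2 - 2 / (d : ℝ)) := by
  have ha := two_sub_two_div_mem hd
  rw [optimalValue, EReal.coe_add, EReal.coe_mul, hf.coe_toReal (by norm_num),
    hf.coe_toReal ⟨by linarith [ha.1], by linarith [ha.2]⟩]
  rfl

/-! ### The potential at a facet normal -/

section FacetNormal

variable {x v₀ : EuclideanSpace ℝ (Fin d)} {s : ℝ}

/-- Since `s / d < 1`, `x` is not a point of `ω`; the potential there is real even if `f 0 = ⊤`. -/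
lemma norm_sub_sq_mem_Ioc_of_inner_le (hd : 2 ≤ d) (hω : IsConfig d ω) (hx : ‖x‖ = 1)
    (hs0 : 0 ≤ s) (hs1 : s ≤ 1) (h₀ : inner ℝ x v₀ ≤ -s)
    (hle : ∀ v ∈ ω, v ≠ v₀ → inner ℝ x v ≤ s / d) {v : EuclideanSpace ℝ (Fin d)} (hv : v ∈ ω) :
    ‖x - v‖ ^ 2 ∈ Ioc (0 : ℝ) 4 := by
  have hd' : (2 : ℝ) ≤ d := by exact_mod_cast hd
  have hvn : ‖v‖ = 1 := mem_unitSphere_iff.1 (hω.1 hv)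
  refine ⟨?_, (norm_sub_sq_mem_Icc hx hvn).2⟩
  rw [norm_sub_sq_of_mem_unitSphere hx hvn]
  have hsd : s / d < 1 := by rw [div_lt_one (by linarith)]; linarith
  by_cases h : v = v₀
  · subst h; linarith
  · linarith [hle v hv h]

lemma facet_distances_mem (hd : 2 ≤ d) (hs0 : 0 ≤ s) (hs1 : s ≤ 1) :
    2 - 2 * (s / d) ∈ Ioc (0 : ℝ) 4 ∧ 2 + 2 * s ∈ Ioc (0 : ℝ) 4 := by
  have hd' : (2 : ℝ) ≤ d := by exact_mod_cast hd
  have hsd : s / d < 1 := by rw [div_lt_one (by linarith)]; linarith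
  have hsd0 : 0 ≤ s / d := by positivity
  exact ⟨⟨by linarith, by linarith⟩, ⟨by linarith, by linarith⟩⟩

lemma sum_le_of_inner_le (hd : 2 ≤ d) (hf : IsAdmissible f) (hω : IsConfig d ω) (hx : ‖x‖ = 1)
    (hv₀ : v₀ ∈ ω) (hs0 : 0 ≤ s) (hs1 : s ≤ 1) (h₀ : inner ℝ x v₀ ≤ -s)
    (hle : ∀ v ∈ ω, v ≠ v₀ → inner ℝ x v ≤ s / d) :
    ∑ v ∈ ω, (f (‖x - v‖ ^ 2)).toReal ≤
      d * (f (2 - 2 * (s / d))).toReal + (f (2 + 2 * s)).toReal := by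
  classical
  have hmem := fun v hv => norm_sub_sq_mem_Ioc_of_inner_le hd hω hx hs0 hs1 h₀ hle (v := v) hv
  obtain ⟨hm1, hm2⟩ := facet_distances_mem hd hs0 hs1
  have hnorm : ∀ v ∈ ω, ‖x - v‖ ^ 2 = 2 - 2 * inner ℝ x v := fun v hv =>
    norm_sub_sq_of_mem_unitSphere hx (mem_unitSphere_iff.1 (hω.1 hv))
  rw [← Finset.sum_erase_add _ _ hv₀]
  refine add_le_add ?_ (hf.toReal_antitone hm2 (hmem v₀ hv₀) (by rw [hnorm v₀ hv₀]; linarith))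
  have hcard : (ω.erase v₀).card = d := by rw [Finset.card_erase_of_mem hv₀, hω.2]; omega
  have := Finset.sum_le_card_nsmul (ω.erase v₀) (fun v => (f (‖x - v‖ ^ 2)).toReal)
    (f (2 - 2 * (s / d))).toReal fun v hv => by
      have hvω := Finset.mem_of_mem_erase hv
      refine hf.toReal_antitone hm1 (hmem v hvω) ?_
      rw [hnorm v hvω]
      linarith [hle v hvω (Finset.ne_of_mem_erase hv)]
  rwa [hcard, nsmul_eq_mul] at this

lemma minPotential_le_of_inner_le (hd : 2 ≤ d) (hf : IsAdmissible f) (hω : IsConfig d ω)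
    (hx : ‖x‖ = 1) (hv₀ : v₀ ∈ ω) (hs0 : 0 ≤ s) (hs1 : s ≤ 1) (h₀ : inner ℝ x v₀ ≤ -s)
    (hle : ∀ v ∈ ω, v ≠ v₀ → inner ℝ x v ≤ s / d) :
    minPotential f ω ≤ optimalValue d f := by
  refine (minPotential_le hx).trans ?_
  rw [potential_eq_coe hf fun v hv => norm_sub_sq_mem_Ioc_of_inner_le hd hω hx hs0 hs1 h₀ hle hv,
    EReal.coe_le_coe_iff]
  exact (sum_le_of_inner_le hd hf hω hx hv₀ hs0 hs1 h₀ hle).trans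
    (convex_comparison hd hf.convex hs0 hs1)

/-- Any slack in the chain of upper bounds contradicts optimality: strict convexity excludes `s <
1`, and strict monotonicity then excludes `⟪x, v⟫ < 1/d`. -/
lemma inner_eq_of_optimal (hd : 2 ≤ d) (hf : IsAdmissible f)
    (hstrict : StrictConvexOn ℝ (Ioc (0 : ℝ) 4) fun t => (f t).toReal) (hω : IsConfig d ω)
    (hopt : minPotential f ω = optimalValue d f) (hx : ‖x‖ = 1) (hv₀ : v₀ ∈ ω) (hs0 : 0 ≤ s)
    (hs1 : s ≤ 1) (h₀ : inner ℝ x v₀ ≤ -s) (hle : ∀ v ∈ ω, v ≠ v₀ → inner ℝ x v ≤ s / d) :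
    ∀ v ∈ ω, v ≠ v₀ → inner ℝ v₀ v = -1 / (d : ℝ) := by
  classical
  have hmem := fun v hv => norm_sub_sq_mem_Ioc_of_inner_le hd hω hx hs0 hs1 h₀ hle (v := v) hv
  have hge : optimalValue d f ≤ ∑ v ∈ ω, (f (‖x - v‖ ^ 2)).toReal := by
    rw [← EReal.coe_le_coe_iff, ← potential_eq_coe hf hmem, ← hopt]
    exact minPotential_le hx
  have hup := sum_le_of_inner_le hd hf hω hx hv₀ hs0 hs1 h₀ hle
  obtain rfl : s = 1 := by
    by_contra hne
    have := strictConvex_comparison hd hstrict hs0 (lt_of_le_of_ne hs1 hne)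
    unfold optimalValue at hge
    linarith
  have hnorm : ∀ v ∈ ω, ‖x - v‖ ^ 2 = 2 - 2 * inner ℝ x v := fun v hv =>
    norm_sub_sq_of_mem_unitSphere hx (mem_unitSphere_iff.1 (hω.1 hv))
  have hx0 : x = -v₀ := by
    have h1 : inner ℝ x (-v₀) = (1 : ℝ) := by
      have := abs_real_inner_le_norm x v₀
      rw [hx, mem_unitSphere_iff.1 (hω.1 hv₀), mul_one] at this
      rw [inner_neg_right]
      linarith [(abs_le.1 this).1]
    exact (inner_eq_one_iff_of_norm_eq_one hx
      (by rw [norm_neg]; exact mem_unitSphere_iff.1 (hω.1 hv₀))).1 h1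
  have hanti := strictAntiOn_of_strictConvexOn hf.toReal_antitone hstrict
  obtain ⟨hm1, hm2⟩ := facet_distances_mem hd zero_le_one (le_refl (1 : ℝ))
  have hcard : (ω.erase v₀).card = d := by rw [Finset.card_erase_of_mem hv₀, hω.2]; omega
  intro v hv hne
  have hv' : v ∈ ω.erase v₀ := Finset.mem_erase.2 ⟨hne, hv⟩
  by_contra hcon
  have hlt : inner ℝ x v < 1 / (d : ℝ) := by
    refine lt_of_le_of_ne (hle v hv hne) fun h => hcon ?_
    rw [hx0, inner_neg_left] at h
    rw [neg_div, ← h, neg_neg]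
  have hsum : ∑ v ∈ ω.erase v₀, (f (‖x - v‖ ^ 2)).toReal <
      ∑ _v ∈ ω.erase v₀, (f (2 - 2 * (1 / d))).toReal := by
    refine Finset.sum_lt_sum (fun w hw => ?_) ⟨v, hv', ?_⟩
    · have hwω := Finset.mem_of_mem_erase hw
      refine hf.toReal_antitone hm1 (hmem w hwω) ?_
      rw [hnorm w hwω]
      linarith [hle w hwω (Finset.ne_of_mem_erase hw)]
    · refine hanti hm1 (hmem v hv) ?_
      rw [hnorm v hv]
      linarith
  rw [Finset.sum_const, hcard, nsmul_eq_mul] at hsum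
  have h4 : (f (‖x - v₀‖ ^ 2)).toReal = (f 4).toReal := by
    have h2 : ‖x - v₀‖ ^ 2 = 4 := by
      have h3 := (hmem v₀ hv₀).2
      have h5 := hnorm v₀ hv₀
      linarith
    rw [h2]
  rw [← Finset.sum_erase_add _ _ hv₀, h4, optimalValue] at hge
  rw [show 2 - 2 * (1 / (d : ℝ)) = 2 - 2 / d by ring] at hsum
  linarith

end FacetNormal

/-! ### Optimality and uniqueness -/

lemma minPotential_le_optimalValue (hd : 2 ≤ d) (hf : IsAdmissible f) (hω : IsConfig d ω) :
    minPotential f ω ≤ optimalValue d f := by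
  obtain ⟨c, hc, hne, hsum⟩ := exists_relation hω.2
  obtain ⟨v₀, hv₀, hmin⟩ := ω.exists_min_image c (Finset.card_pos.1 (by rw [hω.2]; omega))
  obtain ⟨x, s, hx, hs0, hs1, h₀, hle⟩ :=
    exists_unit_inner_le (by omega) hω hc hne hsum hv₀ hmin
  exact minPotential_le_of_inner_le hd hf hω hx hv₀ hs0 hs1 h₀ hle

lemma isRegularSimplex_of_optimal (hd : 2 ≤ d) (hf : IsAdmissible f)
    (hstrict : StrictConvexOn ℝ (Ioc (0 : ℝ) 4) fun t => (f t).toReal) (hω : IsConfig d ω)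
    (hopt : minPotential f ω = optimalValue d f) : IsRegularSimplex d ω := by
  classical
  have hd' : (0 : ℝ) < d := by exact_mod_cast (by omega : 0 < d)
  obtain ⟨c, hc, hne, hsum⟩ := exists_relation hω.2
  have key : ∀ v₀ ∈ ω, (∀ v ∈ ω, c v₀ ≤ c v) →
      ∀ v ∈ ω, v ≠ v₀ → inner ℝ v₀ v = -1 / (d : ℝ) := by
    intro v₀ hv₀ hmin
    obtain ⟨x, s, hx, hs0, hs1, h₀, hle⟩ :=
      exists_unit_inner_le (by omega) hω hc hne hsum hv₀ hmin
    exact inner_eq_of_optimal hd hf hstrict hω hopt hx hv₀ hs0 hs1 h₀ hle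
  obtain ⟨v₀, hv₀, hmin⟩ := ω.exists_min_image c (Finset.card_pos.1 (by rw [hω.2]; omega))
  -- Pairing the relation with `v₀` makes the least weight equal to the average, so all weights
  -- coincide and `key` applies at every point.
  have havg : ∑ v ∈ ω, c v = ∑ _v ∈ ω, c v₀ := by
    have h1 : ∑ v ∈ ω, c v * inner ℝ v₀ v = 0 := by
      have := congrArg (inner ℝ v₀) hc
      simpa [inner_sum, real_inner_smul_right] using this
    rw [← Finset.add_sum_erase _ _ hv₀, Finset.sum_congr rfl (fun v hv => by
      rw [key v₀ hv₀ hmin v (Finset.mem_of_mem_erase hv) (Finset.ne_of_mem_erase hv)]),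
      ← Finset.sum_mul, real_inner_self_eq_norm_sq, mem_unitSphere_iff.1 (hω.1 hv₀)] at h1
    rw [Finset.sum_const, hω.2, nsmul_eq_mul, ← Finset.add_sum_erase _ _ hv₀]
    push_cast
    field_simp at h1
    linarith
  have hall : ∀ v ∈ ω, c v₀ = c v := (Finset.sum_eq_sum_iff_of_le hmin).1 havg.symm
  refine isRegularSimplex_of_inner_eq (by omega) hω fun v hv w hw hvw => ?_
  exact key v hv (fun u hu => by rw [← hall v hv, ← hall u hu]) w hw hvw.symm

/-- The bound extends to `t = 0` by passing to the limit, also when `f 0 = ⊤`. -/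
lemma IsAdmissible.exists_quadratic_le (hd : 2 ≤ d) (hf : IsAdmissible f) :
    ∃ A B C : ℝ, (∀ t ∈ Icc (0 : ℝ) 4, ((A * t ^ 2 + B * t + C : ℝ) : EReal) ≤ f t) ∧
      A * (2 - 2 / (d : ℝ)) ^ 2 + B * (2 - 2 / (d : ℝ)) + C = (f (2 - 2 / (d : ℝ))).toReal ∧
      A * 4 ^ 2 + B * 4 + C = (f 4).toReal := by
  have ha := two_sub_two_div_mem hd
  obtain ⟨A, B, C, hle, h1, h2⟩ := Polarization.exists_quadratic_le
    (by linarith [ha.1] : 0 < 2 - 2 / (d : ℝ)) (by linarith [ha.2] : 2 - 2 / (d : ℝ) < 4)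
    (continuousOn_Ioc_of_convexOn_of_antitoneOn (by norm_num) hf.convex hf.toReal_antitone)
    hf.differentiable hf.concave_deriv
  have hle' : ∀ t ∈ Ioc (0 : ℝ) 4, ((A * t ^ 2 + B * t + C : ℝ) : EReal) ≤ f t := by
    intro t ht
    rw [← hf.coe_toReal ht, EReal.coe_le_coe_iff]
    exact hle t ht
  refine ⟨A, B, C, fun t ht => ?_, h1, h2⟩
  rcases eq_or_lt_of_le ht.1 with rfl | h0
  · have hq : Tendsto (fun t : ℝ => ((A * t ^ 2 + B * t + C : ℝ) : EReal)) (𝓝[>] 0)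
        (𝓝 ((A * 0 ^ 2 + B * 0 + C : ℝ) : EReal)) := by
      refine (Continuous.tendsto ?_ 0).mono_left nhdsWithin_le_nhds
      exact continuous_coe_real_ereal.comp (by fun_prop)
    refine le_of_tendsto_of_tendsto hq hf.tendsto_zero ?_
    filter_upwards [Ioc_mem_nhdsGT (by norm_num : (0 : ℝ) < 4)] with t ht using hle' t ht
  · exact hle' t ⟨h0, ht.2⟩

lemma IsRegularSimplex.minPotential_eq (hd : 2 ≤ d) (hf : IsAdmissible f)
    (h : IsRegularSimplex d ω) : minPotential f ω = optimalValue d f := by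
  have hd' : (0 : ℝ) < d := by exact_mod_cast (by omega : 0 < d)
  have hω := h.isConfig
  refine le_antisymm (minPotential_le_optimalValue hd hf hω) (le_sInf ?_)
  rintro _ ⟨x, hx, rfl⟩
  have hx1 := mem_unitSphere_iff.1 hx
  have hn : ∀ v ∈ ω, ‖v‖ = 1 := fun v hv => mem_unitSphere_iff.1 (h.1 hv)
  obtain ⟨A, B, C, hle, h1, h2⟩ := hf.exists_quadratic_le hd
  obtain ⟨m1, m2⟩ := h.moments (by omega) hx1
  -- Substituting `‖x - v‖ ^ 2 = 2 - 2⟪x, v⟫` leaves only the first two moments, which do not depend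
  -- on `x`.
  have hsum : ∑ v ∈ ω, (A * (‖x - v‖ ^ 2) ^ 2 + B * ‖x - v‖ ^ 2 + C) = optimalValue d f := by
    calc ∑ v ∈ ω, (A * (‖x - v‖ ^ 2) ^ 2 + B * ‖x - v‖ ^ 2 + C)
        = ∑ v ∈ ω, (4 * A * (inner ℝ x v) ^ 2 - (8 * A + 2 * B) * inner ℝ x v +
            (4 * A + 2 * B + C)) :=
          Finset.sum_congr rfl fun v hv => by
            rw [norm_sub_sq_of_mem_unitSphere hx1 (hn v hv)]; ring
      _ = 4 * A * (((d : ℝ) + 1) / d) - (8 * A + 2 * B) * 0 +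
            ((d : ℝ) + 1) * (4 * A + 2 * B + C) := by
          rw [Finset.sum_add_distrib, Finset.sum_sub_distrib, ← Finset.mul_sum, ← Finset.mul_sum,
            m1, m2, Finset.sum_const, hω.2, nsmul_eq_mul]
          push_cast
          ring
      _ = optimalValue d f := by
          rw [optimalValue, ← h1, ← h2]
          field_simp
          ring
  rw [← hsum, coe_sum_ereal]
  exact Finset.sum_le_sum fun v hv => hle _ (norm_sub_sq_mem_Icc hx1 (hn v hv))

lemma maxPolarization_eq (hd : 2 ≤ d) (hf : IsAdmissible f) (h : IsRegularSimplex d ω) :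
    maxPolarization d f = minPotential f ω := by
  refine le_antisymm (sSup_le ?_) (le_sSup ⟨ω, h.isConfig, rfl⟩)
  rintro _ ⟨ω', hω', rfl⟩
  rw [h.minPotential_eq hd hf]
  exact minPotential_le_optimalValue hd hf hω'

end Polarization

theorem theorem2p1 (d : ℕ) (hd : 2 ≤ d) (f : ℝ → EReal) (hf : Polarization.IsAdmissible f) :
    -- regular simplices inscribed in the sphere exist, and are `(d+1)`-point configurations
    (∃ ω : Finset (EuclideanSpace ℝ (Fin d)), Polarization.IsRegularSimplex d ω) ∧
    (∀ ω : Finset (EuclideanSpace ℝ (Fin d)), Polarization.IsRegularSimplex d ω →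
      Polarization.IsConfig d ω) ∧
    -- the infimum defining `P_f(ω, S^{d-1})` is a minimum
    (∀ ω : Finset (EuclideanSpace ℝ (Fin d)), Polarization.IsConfig d ω →
      ∃ x ∈ Polarization.unitSphere d,
        Polarization.potential f ω x = Polarization.minPotential f ω) ∧
    -- every regular simplex is optimal
    (∀ ω ω' : Finset (EuclideanSpace ℝ (Fin d)),
      Polarization.IsConfig d ω → Polarization.IsRegularSimplex d ω' →
        Polarization.minPotential f ω ≤ Polarization.minPotential f ω') ∧
    -- the optimal value
    (∀ ω' : Finset (EuclideanSpace ℝ (Fin d)), Polarization.IsRegularSimplex d ω' →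
      Polarization.maxPolarization d f = Polarization.minPotential f ω' ∧
      Polarization.minPotential f ω' = f 4 + (d : EReal) * f (2 - 2 / (d : ℝ))) ∧
    -- uniqueness when `f` is strictly convex
    (StrictConvexOn ℝ (Set.Ioc (0 : ℝ) 4) (fun t => (f t).toReal) →
      ∀ ω ω' : Finset (EuclideanSpace ℝ (Fin d)),
        Polarization.IsConfig d ω → Polarization.IsRegularSimplex d ω' →
          (Polarization.minPotential f ω = Polarization.minPotential f ω' ↔
            Polarization.IsRegularSimplex d ω)) := by
  refine ⟨Polarization.exists_isRegularSimplex (by omega), fun ω h => h.isConfig,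
    fun ω hω => Polarization.exists_potential_eq_minPotential hf hω, fun ω ω' hω hω' => ?_,
    fun ω' hω' => ⟨Polarization.maxPolarization_eq hd hf hω', ?_⟩,
    fun hstrict ω ω' hω hω' => ?_⟩
  · rw [hω'.minPotential_eq hd hf]
    exact Polarization.minPotential_le_optimalValue hd hf hω
  · rw [hω'.minPotential_eq hd hf, Polarization.coe_optimalValue hd hf]
  · rw [hω'.minPotential_eq hd hf]
    exact ⟨Polarization.isRegularSimplex_of_optimal hd hf hstrict hω,
      fun h => h.minPotential_eq hd hf⟩
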